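/- Let $E/\mathbb{Q}$ be an elliptic curve. For a prime $p$ let $E_0(\mathbb{Q}_p)\subseteq E(\mathbb{Q}_p)$ be the subgroup of finite index consisting of the points whose reduction on a minimal Weierstrass equation of $E$ over $\mathbb{Z}_p$ is nonsingular, let $c_p(E)=[E(\mathbb{Q}_p):E_0(\mathbb{Q}_p)]$, and let $c(E)=\prod_p c_p(E)$, where $p$ runs over the primes of bad reduction of $E$. If $E(\mathbb{Q})_{\mathrm{tors}}\cong\mathbb{Z}/2\mathbb{Z}\oplus\mathbb{Z}/6\mathbb{Z}$, then $|E(\mathbb{Q})_{\mathrm{tors}}|$, that is $12$, divides $c(E)$. -/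

import Mathlib

namespace WeierstrassCurve

section Valuation

variable {K Γ : Type*} [Field K] [LinearOrderedCommGroupWithZero Γ]

/-- A point `(x, y)` of a Weierstrass curve with integral coefficients is integral and reduces to a
singular point of the reduced curve: both partial derivatives of the equation vanish there. -/
def SingularAt (v : Valuation K Γ) (W : WeierstrassCurve K) (x y : K) : Prop :=
  v x ≤ 1 ∧ v y ≤ 1 ∧ v (W.a₁ * y - (3 * x ^ 2 + 2 * W.a₂ * x + W.a₄)) < 1 ∧
    v (2 * y + W.a₁ * x + W.a₃) < 1

theorem val_mul_lt {v : Valuation K Γ} {a b : K} (ha : v a ≤ 1) (hb : v b < 1) : v (a * b) < 1 := by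
  rw [map_mul]
  exact (mul_le_mul_left ha _).trans_lt (by simpa using hb)

theorem SingularAt.congr {v : Valuation K Γ} {W : WeierstrassCurve K} {x y x' y' : K}
    (h₁ : v W.a₁ ≤ 1) (h₂ : v W.a₂ ≤ 1)
    (h : SingularAt v W x y) (hx : v (x' - x) < 1) (hy : v (y' - y) < 1) :
    SingularAt v W x' y' := by
  obtain ⟨hx0, hy0, h3, h4⟩ := h
  have hx' : v x' ≤ 1 := by
    have := v.map_add_le hx0 hx.le
    rwa [add_sub_cancel] at this
  have hy' : v y' ≤ 1 := by
    have := v.map_add_le hy0 hy.le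
    rwa [add_sub_cancel] at this
  refine ⟨hx', hy', ?_, ?_⟩
  · have e : W.a₁ * y' - (3 * x' ^ 2 + 2 * W.a₂ * x' + W.a₄) =
      (W.a₁ * y - (3 * x ^ 2 + 2 * W.a₂ * x + W.a₄)) +
        (W.a₁ * (y' - y) - (3 * (x' + x) + 2 * W.a₂) * (x' - x)) := by ring
    rw [e]
    refine v.map_add_lt h3 (v.map_sub_lt (val_mul_lt h₁ hy) (val_mul_lt ?_ hx))
    change _ ∈ v.integer
    exact add_mem (mul_mem (ofNat_mem _ _) (add_mem hx' hx0)) (mul_mem (ofNat_mem _ _) h₂)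
  · have e : 2 * y' + W.a₁ * x' + W.a₃ = (2 * y + W.a₁ * x + W.a₃) +
      (2 * (y' - y) + W.a₁ * (x' - x)) := by ring
    rw [e]
    refine v.map_add_lt h4 (v.map_add_lt (val_mul_lt ?_ hy) (val_mul_lt h₁ hx))
    change _ ∈ v.integer
    exact ofNat_mem _ _

theorem SingularAt.neg {v : Valuation K Γ} {W : WeierstrassCurve K} {x y : K}
    (h₁ : v W.a₁ ≤ 1) (h₃ : v W.a₃ ≤ 1)
    (h : SingularAt v W x y) : SingularAt v W x (W.toAffine.negY x y) := by
  obtain ⟨hx, hy, h5, h6⟩ := h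
  have hy' : v (W.toAffine.negY x y) ≤ 1 := by
    change _ ∈ v.integer
    exact sub_mem (sub_mem (neg_mem hy) (mul_mem h₁ hx)) h₃
  refine ⟨hx, hy', ?_, ?_⟩
  · rw [show W.a₁ * W.toAffine.negY x y - (3 * x ^ 2 + 2 * W.a₂ * x + W.a₄) =
      (W.a₁ * y - (3 * x ^ 2 + 2 * W.a₂ * x + W.a₄)) - W.a₁ * (2 * y + W.a₁ * x + W.a₃) by
        rw [Affine.negY]; ring]
    exact v.map_sub_lt h5 (val_mul_lt h₁ h6)
  · rw [show 2 * W.toAffine.negY x y + W.a₁ * x + W.a₃ = -(2 * y + W.a₁ * x + W.a₃) by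
        rw [Affine.negY]; ring, Valuation.map_neg]
    exact h6

/-- If a line of slope `ℓ` through a point of singular reduction meets the curve in two further
points, then one of these has singular reduction, too. -/
theorem SingularAt.line {v : Valuation K Γ} {W : WeierstrassCurve K}
    (h₁ : v W.a₁ ≤ 1) (h₂ : v W.a₂ ≤ 1)
    {x y ℓ d e : K} (h : SingularAt v W x y)
    (hs : d + e = ℓ ^ 2 + W.a₁ * ℓ - 3 * x - W.a₂)
    (hp : d * e = (3 * x ^ 2 + 2 * W.a₂ * x + W.a₄) - W.a₁ * y
      - ℓ * (2 * y + W.a₁ * x + W.a₃)) :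
    SingularAt v W (x + d) (y + ℓ * d) ∨ SingularAt v W (x + e) (y + ℓ * e) := by
  obtain ⟨hx, hy, h5, h6⟩ := id h
  have hc : v (3 * x + W.a₂) ≤ 1 := by
    change _ ∈ v.integer
    exact add_mem (mul_mem (ofNat_mem _ _) hx) h₂
  rcases le_or_gt (v ℓ) 1 with hℓ | hℓ
  · have hp' : v (d * e) < 1 := by
      rw [hp, ← Valuation.map_neg]
      rw [show -((3 * x ^ 2 + 2 * W.a₂ * x + W.a₄) - W.a₁ * y
        - ℓ * (2 * y + W.a₁ * x + W.a₃)) = (W.a₁ * y - (3 * x ^ 2 + 2 * W.a₂ * x + W.a₄))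
          + ℓ * (2 * y + W.a₁ * x + W.a₃) by ring]
      exact v.map_add_lt h5 (val_mul_lt hℓ h6)
    have key : ∀ t : K, v t < 1 → SingularAt v W (x + t) (y + ℓ * t) := fun t ht ↦
      h.congr h₁ h₂ (by simpa using ht) (by simpa using val_mul_lt hℓ ht)
    have : v d < 1 ∨ v e < 1 := by
      by_contra! hh
      rw [map_mul] at hp'
      exact absurd (one_le_mul hh.1 hh.2) (not_le.mpr hp')
    exact this.imp (key d) (key e)
  · have hℓ0 : ℓ ≠ 0 := by rintro rfl; simp at hℓ
    obtain ⟨u, hu⟩ : ∃ u, u = ℓ⁻¹ := ⟨_, rfl⟩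
    have huℓ : u * ℓ = 1 := by rw [hu, inv_mul_cancel₀ hℓ0]
    have hu1 : v u < 1 := by rw [hu, map_inv₀]; exact inv_lt_one_of_one_lt₀ hℓ
    -- the two other ordinates, relative to `y`
    have hs' : v (u ^ 2 * (d + e)) = 1 := by
      rw [hs, show u ^ 2 * (ℓ ^ 2 + W.a₁ * ℓ - 3 * x - W.a₂) =
        1 + u * (W.a₁ - u * (3 * x + W.a₂)) by linear_combination (u * ℓ + 1 + u * W.a₁) * huℓ]
      refine v.map_one_add_of_lt ?_
      rw [mul_comm]
      refine val_mul_lt ?_ hu1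
      exact v.map_sub_le h₁ (by rw [map_mul]; exact mul_le_one' hu1.le hc)
    have hp' : v (u * (d * e)) < 1 := by
      rw [hp, show u * ((3 * x ^ 2 + 2 * W.a₂ * x + W.a₄) - W.a₁ * y
        - ℓ * (2 * y + W.a₁ * x + W.a₃)) = -(u * (W.a₁ * y - (3 * x ^ 2 + 2 * W.a₂ * x + W.a₄))
          + (2 * y + W.a₁ * x + W.a₃)) by
            linear_combination (-(2 * y + W.a₁ * x + W.a₃)) * huℓ, Valuation.map_neg]
      exact v.map_add_lt (val_mul_lt hu1.le h5) h6
    have key : ∀ s t : K, v s ≤ v t → v (u ^ 2 * (s + t)) = 1 → v (u * (s * t)) < 1 →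
        SingularAt v W (x + s) (y + ℓ * s) := by
      intro s t hst h7 h8
      have h9 : 1 ≤ v (u ^ 2 * t) := by
        rw [← h7, map_mul, map_mul]
        refine mul_le_mul_right ?_ _
        exact v.map_add_le hst le_rfl
      have h10 : v (ℓ * s) < 1 := by
        by_contra! h11
        have := one_le_mul h9 h11
        rw [← map_mul, show u ^ 2 * t * (ℓ * s) = u * (s * t) by
          linear_combination (u * s * t) * huℓ] at this
        exact absurd this (not_le.mpr h8)
      refine h.congr h₁ h₂ ?_ (by simpa using h10)
      have := val_mul_lt hu1.le h10
      rw [← mul_assoc, huℓ, one_mul] at this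
      simpa using this
    rcases le_total (v d) (v e) with hde | hde
    · exact .inl (key d e hde hs' hp')
    · exact .inr (key e d hde (by rwa [add_comm]) (by rwa [mul_comm e]))

theorem SingularAt.of_add [DecidableEq K] {v : Valuation K Γ} {W : WeierstrassCurve K}
    (h₁ : v W.a₁ ≤ 1) (h₂ : v W.a₂ ≤ 1) (h₃ : v W.a₃ ≤ 1) {x₁ y₁ x₂ y₂ : K}
    (e₁ : W.toAffine.Equation x₁ y₁) (e₂ : W.toAffine.Equation x₂ y₂)
    (hxy : ¬(x₁ = x₂ ∧ y₁ = W.toAffine.negY x₂ y₂))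
    (h : SingularAt v W (W.toAffine.addX x₁ x₂ (W.toAffine.slope x₁ x₂ y₁ y₂))
      (W.toAffine.addY x₁ x₂ y₁ (W.toAffine.slope x₁ x₂ y₁ y₂))) :
    SingularAt v W x₁ y₁ ∨ SingularAt v W x₂ y₂ := by
  have hadd := Affine.addPolynomial_slope e₁ e₂ hxy
  have hy₂ : y₂ = W.toAffine.slope x₁ x₂ y₁ y₂ * (x₂ - x₁) + y₁ := by
    by_cases hx : x₁ = x₂
    · have := Affine.Y_eq_of_Y_ne e₁ e₂ hx (fun h ↦ hxy ⟨hx, h⟩)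
      rw [← this, hx]; ring
    · rw [Affine.slope_of_X_ne hx]
      have : x₁ - x₂ ≠ 0 := sub_ne_zero.mpr hx
      field_simp
      ring
  replace h := h.neg h₁ h₃
  rw [Affine.addY, Affine.negY_negY, Affine.negAddY] at h
  set ℓ := W.toAffine.slope x₁ x₂ y₁ y₂
  have hs : x₁ + x₂ + W.toAffine.addX x₁ x₂ ℓ = ℓ ^ 2 + W.a₁ * ℓ - W.a₂ := by
    rw [Affine.addX]; ring
  set x := W.toAffine.addX x₁ x₂ ℓ
  rw [Affine.addPolynomial_eq, neg_inj, Cubic.prod_X_sub_C_eq, Cubic.toPoly_injective,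
    Cubic.mk.injEq] at hadd
  obtain ⟨-, -, hp, -⟩ := hadd
  have := h.line h₁ h₂ (ℓ := ℓ) (d := x₁ - x) (e := x₂ - x) (by linear_combination hs) (by
    linear_combination (-2 * x) * hs - hp)
  rw [show ℓ * (x - x₁) + y₁ + ℓ * (x₁ - x) = y₁ by ring,
    show ℓ * (x - x₁) + y₁ + ℓ * (x₂ - x) = y₂ by rw [hy₂]; ring, add_sub_cancel,
    add_sub_cancel] at this
  exact this

/-- The two partial derivatives at an integral point are not both smaller than the discriminant. -/
theorem not_val_partials_lt_val_Δ {v : Valuation K Γ} {W : WeierstrassCurve K}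
    (h₁ : v W.a₁ ≤ 1) (h₂ : v W.a₂ ≤ 1) (h₃ : v W.a₃ ≤ 1) (h₄ : v W.a₄ ≤ 1) {x y : K}
    (hx : v x ≤ 1) (hy : v y ≤ 1) (e : W.toAffine.Equation x y)
    (hX : v (W.a₁ * y - (3 * x ^ 2 + 2 * W.a₂ * x + W.a₄)) < v W.Δ)
    (hY : v (2 * y + W.a₁ * x + W.a₃) < v W.Δ) : False := by
  rw [Affine.equation_iff] at e
  have e6 : W.a₆ = y ^ 2 + W.a₁ * x * y + W.a₃ * y - (x ^ 3 + W.a₂ * x ^ 2 + W.a₄ * x) := by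
    linear_combination -e
  obtain ⟨A, B, hA, hB, hΔ⟩ : ∃ A B : K, v A ≤ 1 ∧ v B ≤ 1 ∧
      W.Δ = A * (W.a₁ * y - (3 * x ^ 2 + 2 * W.a₂ * x + W.a₄)) +
        B * (2 * y + W.a₁ * x + W.a₃) := by
    -- the coefficients of the equation translated to have `(x, y)` as its origin
    obtain ⟨p, hp⟩ : ∃ p, p = W.a₂ + 3 * x := ⟨_, rfl⟩
    obtain ⟨q, hq⟩ : ∃ q, q = 2 * y + W.a₁ * x + W.a₃ := ⟨_, rfl⟩
    obtain ⟨r, hr⟩ : ∃ r, r = -(W.a₁ * y - (3 * x ^ 2 + 2 * W.a₂ * x + W.a₄)) := ⟨_, rfl⟩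
    have hp1 : p ∈ v.integer := hp ▸ add_mem h₂ (mul_mem (ofNat_mem _ _) hx)
    have hq1 : q ∈ v.integer :=
      hq ▸ add_mem (add_mem (mul_mem (ofNat_mem _ _) hy) (mul_mem h₁ hx)) h₃
    have hr1 : r ∈ v.integer := hr ▸ neg_mem (sub_mem (mul_mem h₁ hy)
      (add_mem (add_mem (mul_mem (ofNat_mem _ _) (pow_mem hx 2))
        (mul_mem (mul_mem (ofNat_mem _ _) h₂) hx)) h₄))
    have h1 : W.a₁ ∈ v.integer := h₁
    let b : K := W.a₁ ^ 2 + 4 * p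
    let c : K := 2 * r + W.a₁ * q
    have hb : b ∈ v.integer := add_mem (pow_mem h1 2) (mul_mem (ofNat_mem _ _) hp1)
    have hc : c ∈ v.integer := add_mem (mul_mem (ofNat_mem _ _) hr1) (mul_mem h1 hq1)
    refine ⟨-(b ^ 2 * (W.a₁ * q + r) - 16 * c ^ 2),
      -b ^ 2 * (p * q) - 8 * c ^ 2 * W.a₁ - 27 * q ^ 3 + 9 * b * c * q, ?_, ?_, ?_⟩
    · change _ ∈ v.integer
      exact neg_mem (sub_mem (mul_mem (pow_mem hb 2) (add_mem (mul_mem h1 hq1) hr1))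
        (mul_mem (ofNat_mem _ _) (pow_mem hc 2)))
    · change _ ∈ v.integer
      exact add_mem (sub_mem (sub_mem (mul_mem (neg_mem (pow_mem hb 2)) (mul_mem hp1 hq1))
        (mul_mem (mul_mem (ofNat_mem _ _) (pow_mem hc 2)) h1))
        (mul_mem (ofNat_mem _ _) (pow_mem hq1 3)))
        (mul_mem (mul_mem (mul_mem (ofNat_mem _ _) hb) hc) hq1)
    · simp only [b, c, hp, hq, hr, Δ, b₂, b₄, b₆, b₈, e6]
      ring
  have : v W.Δ < v W.Δ := by
    conv_lhs => rw [hΔ]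
    refine v.map_add_lt ?_ ?_ <;> rw [map_mul]
    · exact (mul_le_of_le_one_left' hA).trans_lt hX
    · exact (mul_le_of_le_one_left' hB).trans_lt hY
  exact this.false

/-- The difference of two integral points which are close to each other is not integral. -/
theorem one_lt_val_sub [DecidableEq K] {v : Valuation K Γ} {W : WeierstrassCurve K}
    (h₁ : v W.a₁ ≤ 1) (h₂ : v W.a₂ ≤ 1) (h₃ : v W.a₃ ≤ 1) (h₄ : v W.a₄ ≤ 1)
    {x₁ y₁ x₂ y₂ : K} (e₁ : W.toAffine.Equation x₁ y₁) (e₂ : W.toAffine.Equation x₂ y₂)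
    (hx₁ : v x₁ ≤ 1) (hy₁ : v y₁ ≤ 1) (hx₂ : v x₂ ≤ 1)
    (hx : v (x₁ - x₂) < v W.Δ) (hy : v (y₁ - y₂) < v W.Δ)
    (hxy : ¬(x₁ = x₂ ∧ y₁ = W.toAffine.negY x₂ (W.toAffine.negY x₂ y₂))) :
    1 < v (W.toAffine.addX x₁ x₂
      (W.toAffine.slope x₁ x₂ y₁ (W.toAffine.negY x₂ y₂))) := by
  have key : W.toAffine.slope x₁ x₂ y₁ (W.toAffine.negY x₂ y₂) * (x₁ - x₂) =
        y₁ + y₂ + W.a₁ * x₂ + W.a₃ ∧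
      W.toAffine.slope x₁ x₂ y₁ (W.toAffine.negY x₂ y₂) * (y₁ - y₂) =
        x₁ ^ 2 + x₁ * x₂ + x₂ ^ 2 + W.a₂ * (x₁ + x₂) + W.a₄ - W.a₁ * y₁ := by
    by_cases h : x₁ = x₂
    · have h' : y₁ ≠ W.toAffine.negY x₂ (W.toAffine.negY x₂ y₂) := fun h' ↦ hxy ⟨h, h'⟩
      have hy' := Affine.Y_eq_of_Y_ne e₁ ((Affine.equation_neg ..).mpr e₂) h h'
      rw [Affine.slope_of_Y_ne h h']
      rw [Affine.negY_negY] at h'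
      have h'' : y₁ - y₂ ≠ 0 := sub_ne_zero.mpr h'
      have : W.toAffine.negY x₁ y₁ = y₂ := by rw [hy', h, Affine.negY_negY]
      rw [this, div_mul_cancel₀ _ h'']
      subst h
      refine ⟨?_, by ring⟩
      rw [hy', Affine.negY]
      ring
    · have h' : x₁ - x₂ ≠ 0 := sub_ne_zero.mpr h
      rw [Affine.slope_of_X_ne h]
      rw [Affine.equation_iff] at e₁ e₂
      refine ⟨?_, ?_⟩
      · rw [div_mul_cancel₀ _ h', Affine.negY]
        ring
      · rw [div_mul_eq_mul_div, div_eq_iff h', Affine.negY]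
        linear_combination e₁ - e₂
  generalize W.toAffine.slope x₁ x₂ y₁ (W.toAffine.negY x₂ y₂) = ℓ at key
  obtain ⟨k₁, k₂⟩ := key
  have mul_lt : ∀ {a b : K}, v a ≤ 1 → v b < v W.Δ → v (a * b) < v W.Δ := fun ha hb ↦ by
    rw [map_mul]; exact (mul_le_of_le_one_left' ha).trans_lt hb
  have hℓ : 1 < v ℓ := by
    by_contra! hℓ
    refine not_val_partials_lt_val_Δ h₁ h₂ h₃ h₄ hx₁ hy₁ e₁ ?_ ?_
    · rw [show W.a₁ * y₁ - (3 * x₁ ^ 2 + 2 * W.a₂ * x₁ + W.a₄) =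
        (-ℓ) * (y₁ - y₂) - (2 * x₁ + x₂ + W.a₂) * (x₁ - x₂) by linear_combination k₂]
      refine v.map_sub_lt (mul_lt (by rwa [Valuation.map_neg]) hy) (mul_lt ?_ hx)
      change _ ∈ v.integer
      exact add_mem (add_mem (mul_mem (ofNat_mem _ _) hx₁) hx₂) h₂
    · rw [show 2 * y₁ + W.a₁ * x₁ + W.a₃ = ℓ * (x₁ - x₂) + ((y₁ - y₂) + W.a₁ * (x₁ - x₂)) by
        linear_combination -k₁]
      exact v.map_add_lt (mul_lt hℓ hx) (v.map_add_lt hy (mul_lt h₁ hx))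
  by_contra! h
  have h5 : v (ℓ * (ℓ + W.a₁)) ≤ 1 := by
    rw [show ℓ * (ℓ + W.a₁) = W.toAffine.addX x₁ x₂ ℓ + W.a₂ + x₁ + x₂ by rw [Affine.addX]; ring]
    change _ ∈ v.integer
    exact add_mem (add_mem (add_mem h h₂) hx₁) hx₂
  rw [map_mul, v.map_add_eq_of_lt_left (h₁.trans_lt hℓ)] at h5
  exact absurd (one_lt_mul'' hℓ hℓ) (not_lt.mpr h5)

end Valuation

section Reduction

variable (R : Type*) [CommRing R] [IsDomain R] [IsDiscreteValuationRing R]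
  {K : Type*} [Field K] [Algebra R K] [IsFractionRing R K]

/-- Let `W` be a minimal Weierstrass equation over the fraction field `K` of a discrete valuation
ring `R`. A point of `W(K)` has nonsingular reduction if its reduction is not a singular point of
the reduced curve over the residue field. The point at infinity, and the affine points whose
coordinates are not both in `R`, reduce to the point at infinity of the reduced curve, which is
nonsingular. An affine point with coordinates `x₀, y₀` in `R` reduces to `(x₀ mod 𝔪, y₀ mod 𝔪)`. -/
def HasNonsingularReduction (W : WeierstrassCurve K) [W.IsMinimal R] : W.toAffine.Point → Prop
  | .zero => True
  | .some x y _ => ∀ x₀ y₀ : R, algebraMap R K x₀ = x → algebraMap R K y₀ = y →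
      (W.reduction R).toAffine.Nonsingular (IsLocalRing.residue R x₀) (IsLocalRing.residue R y₀)

open IsDedekindDomain.HeightOneSpectrum IsDiscreteValuationRing

theorem hasNonsingularReduction_some_iff (W : WeierstrassCurve K) [W.IsMinimal R] {x y : K}
    (h : W.toAffine.Nonsingular x y) :
    W.HasNonsingularReduction R (.some x y h) ↔
      ¬ SingularAt (valuation K (maximalIdeal R)) W x y := by
  have lt_iff : ∀ r : R, valuation K (maximalIdeal R) (algebraMap R K r) < 1 ↔
      IsLocalRing.residue R r = 0 := fun r ↦ by
    rw [IsLocalRing.residue_eq_zero_iff]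
    exact valuation_lt_one_iff_mem _ _
  have red : ∀ x₀ y₀ : R, algebraMap R K x₀ = x → algebraMap R K y₀ = y →
      ((W.reduction R).toAffine.Nonsingular (IsLocalRing.residue R x₀) (IsLocalRing.residue R y₀) ↔
        ¬ SingularAt (valuation K (maximalIdeal R)) W x y) := by
    rintro x₀ y₀ rfl rfl
    have he : (W.integralModel R).toAffine.Equation x₀ y₀ := by
      rw [← Affine.map_equation _ (IsFractionRing.injective R K)]
      have := h.1
      rw [← baseChange_integralModel_eq R W] at this
      exact this
    rw [Affine.nonsingular_iff', reduction, SingularAt, and_iff_right (he.map _),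
      ← integralModel_a₁_eq R W, ← integralModel_a₂_eq R W, ← integralModel_a₃_eq R W,
      ← integralModel_a₄_eq R W]
    simp only [valuation_le_one, true_and, map_a₁, map_a₂, map_a₃, map_a₄]
    have e1 := lt_iff ((W.integralModel R).a₁ * y₀ -
      (3 * x₀ ^ 2 + 2 * (W.integralModel R).a₂ * x₀ + (W.integralModel R).a₄))
    have e2 := lt_iff (2 * y₀ + (W.integralModel R).a₁ * x₀ + (W.integralModel R).a₃)
    simp only [map_add, map_sub, map_mul, map_pow, map_ofNat] at e1 e2
    rw [e1, e2]
    tauto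
  constructor
  · intro H hs
    obtain ⟨x₀, hx₀⟩ := exists_lift_of_le_one hs.1
    obtain ⟨y₀, hy₀⟩ := exists_lift_of_le_one hs.2.1
    exact (red x₀ y₀ hx₀ hy₀).mp (H x₀ y₀ hx₀ hy₀) hs
  · exact fun H x₀ y₀ hx₀ hy₀ ↦ (red x₀ y₀ hx₀ hy₀).mpr H

theorem val_coeff_le_one (W : WeierstrassCurve K) [W.IsIntegral R] :
    valuation K (maximalIdeal R) W.a₁ ≤ 1 ∧ valuation K (maximalIdeal R) W.a₂ ≤ 1 ∧
      valuation K (maximalIdeal R) W.a₃ ≤ 1 ∧ valuation K (maximalIdeal R) W.a₄ ≤ 1 := by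
  rw [← integralModel_a₁_eq R W, ← integralModel_a₂_eq R W, ← integralModel_a₃_eq R W,
    ← integralModel_a₄_eq R W]
  exact ⟨valuation_le_one _ _, valuation_le_one _ _, valuation_le_one _ _, valuation_le_one _ _⟩

/-- The subgroup `E₀(K)` of the points of nonsingular reduction in the group `E(K)` of a minimal
Weierstrass equation. -/
def nonsingularReduction [DecidableEq K] (W : WeierstrassCurve K) [W.IsMinimal R] :
    AddSubgroup W.toAffine.Point where
  carrier := {P | W.HasNonsingularReduction R P}
  zero_mem' := trivial
  neg_mem' := by
    obtain ⟨h₁, -, h₃, -⟩ := val_coeff_le_one R W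
    rintro (_ | ⟨x, y, h⟩) hP
    · trivial
    · simp only [Set.mem_ofPred_eq, Affine.Point.neg_some,
        hasNonsingularReduction_some_iff] at hP ⊢
      exact fun hs ↦ hP (by simpa only [Affine.negY_negY] using hs.neg h₁ h₃)
  add_mem' := by
    obtain ⟨h₁, h₂, h₃, -⟩ := val_coeff_le_one R W
    rintro (_ | ⟨x₁, y₁, e₁⟩) (_ | ⟨x₂, y₂, e₂⟩) hP hQ
    · trivial
    · exact hQ
    · exact hP
    · by_cases hxy : x₁ = x₂ ∧ y₁ = W.toAffine.negY x₂ y₂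
      · rw [Affine.Point.add_of_Y_eq hxy.1 hxy.2]
        trivial
      · rw [Affine.Point.add_some hxy]
        simp only [Set.mem_ofPred_eq, hasNonsingularReduction_some_iff] at hP hQ ⊢
        exact fun hs ↦ (hs.of_add h₁ h₂ h₃ e₁.1 e₂.1 hxy).elim hP hQ

/-- Over a local field, the group `E₀(K)` has finite index in `E(K)`, so that the index below is
not the junk value of an infinite index. -/
theorem finiteIndex_nonsingularReduction [Finite (IsLocalRing.ResidueField R)] [DecidableEq K]
    (W : WeierstrassCurve K) [W.IsElliptic] [W.IsMinimal R] :
    (W.nonsingularReduction R).FiniteIndex := by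
  classical
  obtain ⟨h₁, h₂, h₃, h₄⟩ := val_coeff_le_one R W
  set v := valuation K (maximalIdeal R) with hv
  obtain ⟨δ, hδ⟩ := Δ_integral_of_isIntegral R W
  have hδ0 : δ ≠ 0 := by
    rintro rfl
    rw [map_zero] at hδ
    exact W.isUnit_Δ.ne_zero hδ.symm
  let I : Ideal R := Ideal.span {δ} * IsLocalRing.maximalIdeal R
  have hI : Finite (R ⧸ I) := by
    obtain ⟨ϖ, hϖ⟩ := exists_irreducible R
    obtain ⟨n, hn⟩ := associated_pow_irreducible hδ0 hϖ
    refine IsLocalRing.finite_quotient_iff.mpr ⟨n + 1, ?_⟩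
    have : Ideal.span {δ} = IsLocalRing.maximalIdeal R ^ n := by
      rw [Ideal.span_singleton_eq_span_singleton.mpr hn, hϖ.maximalIdeal_eq,
        Ideal.span_singleton_pow]
    rw [pow_succ, ← this]
  have hlt : ∀ r s : R, Ideal.Quotient.mk I r = Ideal.Quotient.mk I s →
      v (algebraMap R K r - algebraMap R K s) < v W.Δ := by
    intro r s hrs
    obtain ⟨m, hm, hm'⟩ := Ideal.mem_span_singleton_mul.mp (Ideal.Quotient.eq.mp hrs)
    rw [← map_sub, ← hm', map_mul, map_mul, hδ]
    refine mul_lt_of_lt_one_right ?_ ((valuation_lt_one_iff_mem _ _).mpr hm)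
    exact zero_lt_iff.mpr ((Valuation.ne_zero_iff _).mpr W.isUnit_Δ.ne_zero)
  -- the coordinates modulo `I` of a point determine its class
  let f : W.toAffine.Point → Option ((R ⧸ I) × (R ⧸ I)) := fun P ↦
    if h : ∃ (x₀ y₀ : R) (e : W.toAffine.Nonsingular (algebraMap R K x₀) (algebraMap R K y₀)),
      P = .some _ _ e then some (Ideal.Quotient.mk I h.choose,
        Ideal.Quotient.mk I h.choose_spec.choose) else none
  have hf₀ : ∀ P, f P = none → P ∈ W.nonsingularReduction R := by
    intro P hP
    rcases P with _ | ⟨x, y, h⟩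
    · trivial
    · rintro x₀ y₀ rfl rfl
      simp only [f] at hP
      rw [dif_pos ⟨x₀, y₀, h, rfl⟩] at hP
      simp at hP
  have hf₁ : ∀ P a, f P = some a → ∃ (x₀ y₀ : R)
      (e : W.toAffine.Nonsingular (algebraMap R K x₀) (algebraMap R K y₀)),
      P = .some _ _ e ∧ a = (Ideal.Quotient.mk I x₀, Ideal.Quotient.mk I y₀) := by
    intro P a hP
    by_cases h : ∃ (x₀ y₀ : R)
      (e : W.toAffine.Nonsingular (algebraMap R K x₀) (algebraMap R K y₀)), P = .some _ _ e
    · simp only [f, dif_pos h, Option.some.injEq] at hP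
      exact ⟨_, _, h.choose_spec.choose_spec.choose, h.choose_spec.choose_spec.choose_spec,
        hP.symm⟩
    · simp only [f, dif_neg h] at hP
      cases hP
  have hf : ∀ P Q, f P = f Q → P - Q ∈ W.nonsingularReduction R := by
    intro P Q hPQ
    rcases hQ : f Q with _ | a
    · exact sub_mem (hf₀ P (hPQ.trans hQ)) (hf₀ Q hQ)
    · obtain ⟨x₁, y₁, e₁, rfl, ha⟩ := hf₁ P a (hPQ.trans hQ)
      obtain ⟨x₂, y₂, e₂, rfl, ha'⟩ := hf₁ Q a hQ
      rw [ha, Prod.mk.injEq] at ha'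
      rw [sub_eq_add_neg, Affine.Point.neg_some]
      by_cases hxy : algebraMap R K x₁ = algebraMap R K x₂ ∧ algebraMap R K y₁ =
          W.toAffine.negY (algebraMap R K x₂)
            (W.toAffine.negY (algebraMap R K x₂) (algebraMap R K y₂))
      · rw [Affine.Point.add_of_Y_eq hxy.1 hxy.2]
        exact zero_mem _
      · rw [Affine.Point.add_some hxy]
        refine (hasNonsingularReduction_some_iff R W
          (Affine.nonsingular_add e₁ ((Affine.nonsingular_neg ..).mpr e₂) hxy)).mpr fun hs ↦ ?_
        exact absurd hs.1 (not_le.mpr (one_lt_val_sub h₁ h₂ h₃ h₄ e₁.1 e₂.1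
          (valuation_le_one _ _) (valuation_le_one _ _) (valuation_le_one _ _)
          (hlt _ _ ha'.1) (hlt _ _ ha'.2) hxy))
  have : Finite (W.toAffine.Point ⧸ W.nonsingularReduction R) := by
    refine Finite.of_injective (fun q ↦ f q.out) fun q q' hq ↦ ?_
    rw [← QuotientAddGroup.out_eq' q', ← QuotientAddGroup.out_eq' q, QuotientAddGroup.eq,
      add_comm, ← sub_eq_add_neg]
    exact hf _ _ hq.symm
  exact AddSubgroup.finiteIndex_of_finite_quotient

end Reduction

section Tamagawa

open IsDedekindDomain.HeightOneSpectrum IsDiscreteValuationRing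

instance fact_prime_primes (p : Nat.Primes) : Fact (p : ℕ).Prime := ⟨p.2⟩

open Classical in
/-- The Tamagawa number `c_p(E) = [E(ℚ_p) : E₀(ℚ_p)]` at the prime `p` of an elliptic curve `E`
over `ℚ`, computed on a Weierstrass equation of `E` over `ℚ_p` which is minimal over `ℤ_p`. -/
noncomputable def localTamagawaNumber (E : WeierstrassCurve ℚ) (p : ℕ) [Fact p.Prime] : ℕ :=
  (((E.baseChange ℚ_[p]).minimal ℤ_[p]).nonsingularReduction ℤ_[p]).index

/-- An elliptic curve `E` over `ℚ` has bad reduction at `p` if its minimal Weierstrass equation over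
`ℤ_p` does not have good reduction. -/
def HasBadReductionAt (E : WeierstrassCurve ℚ) (p : ℕ) [Fact p.Prime] : Prop :=
  ¬ ((E.baseChange ℚ_[p]).minimal ℤ_[p]).HasGoodReduction ℤ_[p]

/-- The global Tamagawa number `c(E)` of an elliptic curve `E` over `ℚ`, the product of the
`c_p(E)` over all the primes `p` of bad reduction. -/
noncomputable def tamagawaNumber (E : WeierstrassCurve ℚ) : ℕ :=
  ∏ᶠ (p : Nat.Primes) (_ : E.HasBadReductionAt p), E.localTamagawaNumber p

theorem localTamagawaNumber_pos (E : WeierstrassCurve ℚ) [E.IsElliptic] (p : ℕ) [Fact p.Prime] :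
    0 < E.localTamagawaNumber p := by
  classical
  have : Finite (IsLocalRing.ResidueField ℤ_[p]) :=
    .of_equiv _ (PadicInt.residueField (p := p)).symm.toEquiv
  have : ((E.baseChange ℚ_[p]).minimal ℤ_[p]).IsElliptic := by
    rw [minimal, baseChange]
    infer_instance
  have := finiteIndex_nonsingularReduction ℤ_[p] ((E.baseChange ℚ_[p]).minimal ℤ_[p])
  exact Nat.pos_of_ne_zero this.index_ne_zero

/-- An elliptic curve over `ℚ` has bad reduction at only finitely many primes, so that the product
above is a finite product. -/
theorem finite_setOf_hasBadReductionAt (E : WeierstrassCurve ℚ) [E.IsElliptic] :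
    {p : Nat.Primes | E.HasBadReductionAt p}.Finite := by
  have hE : E.Δ ≠ 0 := E.isUnit_Δ.ne_zero
  let N : ℕ := E.a₁.den * E.a₂.den * E.a₃.den * E.a₄.den * E.a₆.den * E.Δ⁻¹.den
  have hN : N ≠ 0 := by
    simp only [N, ne_eq, mul_eq_zero, Rat.den_ne_zero, or_self, not_false_eq_true]
  refine Set.Finite.subset (s := {p : Nat.Primes | (p : ℕ) ∣ N}) ?_ ?_
  · refine Set.Finite.of_finite_image (f := fun p : Nat.Primes ↦ (p : ℕ)) ?_
      Nat.Primes.coe_nat_injective.injOn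
    refine (Set.finite_Iic N).subset ?_
    rintro _ ⟨p, hp, rfl⟩
    exact Nat.le_of_dvd (Nat.pos_of_ne_zero hN) hp
  · intro p hp
    by_contra hpN
    have lift : ∀ q : ℚ, q.den ∣ N → ∃ r : ℤ_[p], algebraMap ℤ_[p] ℚ_[p] r = (q : ℚ_[p]) :=
      fun q hq ↦ ⟨⟨q, Padic.norm_rat_le_one fun h ↦ hpN (h.trans hq)⟩, rfl⟩
    set W := E.baseChange ℚ_[p] with hW
    have hint : W.IsIntegral ℤ_[p] := by
      refine isIntegral_of_exists_lift ℤ_[p] (lift E.a₁ ?_) (lift E.a₂ ?_) (lift E.a₃ ?_)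
        (lift E.a₄ ?_) (lift E.a₆ ?_) <;> simp only [N]
      · exact ⟨E.a₂.den * E.a₃.den * E.a₄.den * E.a₆.den * E.Δ⁻¹.den, by ring⟩
      · exact ⟨E.a₁.den * E.a₃.den * E.a₄.den * E.a₆.den * E.Δ⁻¹.den, by ring⟩
      · exact ⟨E.a₁.den * E.a₂.den * E.a₄.den * E.a₆.den * E.Δ⁻¹.den, by ring⟩
      · exact ⟨E.a₁.den * E.a₂.den * E.a₃.den * E.a₆.den * E.Δ⁻¹.den, by ring⟩
      · exact ⟨E.a₁.den * E.a₂.den * E.a₃.den * E.a₄.den * E.Δ⁻¹.den, by ring⟩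
    have hΔ : valuation ℚ_[p] (maximalIdeal ℤ_[p]) W.Δ = 1 := by
      obtain ⟨r, hr⟩ := lift E.Δ⁻¹ (Dvd.intro_left _ rfl)
      refine le_antisymm ?_ ?_
      · rw [← integralModel_Δ_eq ℤ_[p] W]
        exact valuation_le_one _ _
      · have h1 : W.Δ * algebraMap ℤ_[p] ℚ_[p] r = 1 := by
          rw [hr, hW, baseChange, map_Δ]
          simp only [eq_ratCast, Rat.cast_inv]
          exact mul_inv_cancel₀ (by exact_mod_cast hE)
        have h2 := valuation_le_one (K := ℚ_[p]) (maximalIdeal ℤ_[p]) r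
        have h3 := congrArg (valuation ℚ_[p] (maximalIdeal ℤ_[p])) h1
        rw [map_mul, map_one] at h3
        rw [← h3]
        exact mul_le_of_le_one_right' h2
    refine hp ⟨?_⟩
    set C := (W.exists_isMinimal ℤ_[p]).choose
    have hmin : W.minimal ℤ_[p] = C • W := rfl
    have hM : IsMinimal ℤ_[p] (C • W) := (W.exists_isMinimal ℤ_[p]).choose_spec
    have h := hM.val_Δ_maximal.2 (j := C⁻¹) (by simpa using hint)
    simp only [inv_smul_smul, one_smul] at h
    rw [← Subtype.coe_le_coe, ← Subtype.coe_le_coe, valuation_Δ_aux_eq_of_isIntegral, valuation_Δ_aux_eq_of_isIntegral, hΔ] at h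
    have h1 : valuation ℚ_[p] (maximalIdeal ℤ_[p]) (C • W).Δ ≤ 1 := by
      rw [← integralModel_Δ_eq ℤ_[p] (C • W)]
      exact valuation_le_one _ _
    rw [hmin]
    exact le_antisymm h1 (h h1)

end Tamagawa

end WeierstrassCurve

/-! A point of order 3 moved to the origin, with horizontal tangent, puts the curve in the form y² +
a₁xy + a₃y = x³. Its points of order 2 are (-m², -m³) for the roots m of 2m³ + a₁m² - a₃. This cubic
has no linear term, so its three rational roots have reciprocals with sum zero. Hence the
reciprocals are proportional to A, B, -(A + B) with A, B coprime integers. Exactly one of these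
three is even, and by symmetry A and B can be taken odd. With D = -(A + B)/2 the curve becomes
`twoSixCurve A B D` after scaling (`exists_twoSixCurve`).

On this integral model c₄ is odd, and a point of order 2 is singular mod 2, so 2 divides c₂
(`two_of_twoSixCurve`). At an odd prime p dividing AB, c₄ is a unit and both the origin and a point
of order 2 are singular mod p, so 6 divides c_p (`six_dvd_of_twoSixCurve`). Such a p exists, since
A, B = ±1 would make the curve singular. Therefore 12 divides c₂c_p.

The Tamagawa numbers are defined on a chosen minimal model. Where c₄ of the explicit model is a
unit, the change of variables to any minimal model is integral with unit scaling factor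
(`val_u_eq_one`, `VariableChange.val_le_one`), so singular reduction can be checked on the explicit
model. -/

namespace WeierstrassCurve

/-! ### Integral changes of variables and singular points. -/

section Valuation

variable {K Γ : Type*} [Field K] [LinearOrderedCommGroupWithZero Γ]

/-- A valuation ring is integrally closed: if v x > 1, dividing by x⁴ writes 0 as 1 plus an element
of valuation less than 1. -/
theorem val_le_one_of_quartic {v : Valuation K Γ} {x a b c d : K} (ha : v a ≤ 1) (hb : v b ≤ 1)
    (hc : v c ≤ 1) (hd : v d ≤ 1) (h : x ^ 4 + a * x ^ 3 + b * x ^ 2 + c * x + d = 0) :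
    v x ≤ 1 := by
  by_contra! hx
  have hx0 : x ≠ 0 := by rintro rfl; simp at hx
  have hy : v x⁻¹ < 1 := by rw [map_inv₀]; exact inv_lt_one_of_one_lt₀ hx
  have hy' : x⁻¹ ∈ v.integer := hy.le
  have hm : v (a + x⁻¹ * (b + x⁻¹ * (c + x⁻¹ * d))) ≤ 1 := by
    change _ ∈ v.integer
    exact add_mem ha (mul_mem hy' (add_mem hb (mul_mem hy' (add_mem hc (mul_mem hy' hd)))))
  have h1 := v.map_one_add_of_lt (val_mul_lt hm hy)
  have h0 : 1 + (a + x⁻¹ * (b + x⁻¹ * (c + x⁻¹ * d))) * x⁻¹ = 0 := by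
    field_simp
    linear_combination h
  rw [h0, map_zero] at h1
  exact zero_ne_one h1

theorem val_le_one_of_quadratic {v : Valuation K Γ} {x a b : K} (ha : v a ≤ 1) (hb : v b ≤ 1)
    (h : x ^ 2 + a * x + b = 0) : v x ≤ 1 :=
  val_le_one_of_quartic (c := 0) (d := 0) ha hb (by simp) (by simp)
    (by linear_combination x ^ 2 * h)

/-- A change of variables between two integral Weierstrass equations is integral if its scaling
factor is a unit. -/
theorem VariableChange.val_le_one {v : Valuation K Γ} {W : WeierstrassCurve K}
    {C : VariableChange K} (hu : v C.u = 1)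
    (h₁ : v W.a₁ ≤ 1) (h₂ : v W.a₂ ≤ 1) (h₃ : v W.a₃ ≤ 1) (h₄ : v W.a₄ ≤ 1) (h₆ : v W.a₆ ≤ 1)
    (k₁ : v (C • W).a₁ ≤ 1) (k₂ : v (C • W).a₂ ≤ 1) (k₃ : v (C • W).a₃ ≤ 1)
    (k₄ : v (C • W).a₄ ≤ 1) (k₆ : v (C • W).a₆ ≤ 1) : v C.r ≤ 1 ∧ v C.s ≤ 1 ∧ v C.t ≤ 1 := by
  have hu' : (C.u : K) ∈ v.integer := hu.le
  have b_mem : ∀ V : WeierstrassCurve K, v V.a₁ ≤ 1 → v V.a₂ ≤ 1 → v V.a₃ ≤ 1 → v V.a₄ ≤ 1 →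
      v V.a₆ ≤ 1 → V.b₂ ∈ v.integer ∧ V.b₄ ∈ v.integer ∧ V.b₆ ∈ v.integer ∧ V.b₈ ∈ v.integer := by
    intro V (h₁ : V.a₁ ∈ v.integer) (h₂ : V.a₂ ∈ v.integer) (h₃ : V.a₃ ∈ v.integer)
      (h₄ : V.a₄ ∈ v.integer) (h₆ : V.a₆ ∈ v.integer)
    have n (k : ℕ) [k.AtLeastTwo] : (OfNat.ofNat k : K) ∈ v.integer := ofNat_mem _ _
    refine ⟨add_mem (pow_mem h₁ 2) (mul_mem (n 4) h₂), add_mem (mul_mem (n 2) h₄) (mul_mem h₁ h₃),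
      add_mem (pow_mem h₃ 2) (mul_mem (n 4) h₆), ?_⟩
    exact sub_mem (add_mem (sub_mem (add_mem (mul_mem (pow_mem h₁ 2) h₆)
      (mul_mem (mul_mem (n 4) h₂) h₆)) (mul_mem (mul_mem h₁ h₃) h₄)) (mul_mem h₂ (pow_mem h₃ 2)))
      (pow_mem h₄ 2)
  obtain ⟨-, p₄, p₆, p₈⟩ := b_mem W h₁ h₂ h₃ h₄ h₆
  obtain ⟨-, -, q₆, q₈⟩ := b_mem (C • W) k₁ k₂ k₃ k₄ k₆
  have inv_mul (n : ℕ) : (C.u : K) ^ n * (↑C.u⁻¹) ^ n = 1 := by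
    rw [← mul_pow, Units.mul_inv, one_pow]
  -- Let b₆', b₈' be the invariants of `C • W`. Then u⁸b₈' - r·u⁶b₆' = b₈ + 2rb₆ + r²b₄ - r⁴, which
  -- is a monic quartic equation for r over the valuation ring.
  have hr : v C.r ≤ 1 := by
    refine val_le_one_of_quartic (v := v) (a := 0) (b := -W.b₄)
      (c := -(C.u ^ 6 * (C • W).b₆) - 2 * W.b₆) (d := C.u ^ 8 * (C • W).b₈ - W.b₈) (by simp)
      (neg_mem (s := v.integer) p₄) (sub_mem (H := v.integer)
      (neg_mem (mul_mem (pow_mem hu' 6) q₆)) (mul_mem (ofNat_mem _ _) p₆))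
      (sub_mem (H := v.integer) (mul_mem (pow_mem hu' 8) q₈) p₈) ?_
    rw [variableChange_b₆, variableChange_b₈]
    linear_combination -C.r * (W.b₆ + 2 * C.r * W.b₄ + C.r ^ 2 * W.b₂ + 4 * C.r ^ 3) * inv_mul 6 +
      (W.b₈ + 3 * C.r * W.b₆ + 3 * C.r ^ 2 * W.b₄ + C.r ^ 3 * W.b₂ + 3 * C.r ^ 4) * inv_mul 8
  have hr' : C.r ∈ v.integer := hr
  -- Once r is integral, the transformation formulas for a₂ and a₆ are monic quadratic equations for
  -- s and t respectively.
  refine ⟨hr, ?_, ?_⟩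
  · refine val_le_one_of_quadratic (v := v) (a := W.a₁)
      (b := C.u ^ 2 * (C • W).a₂ - W.a₂ - 3 * C.r) h₁ (sub_mem (H := v.integer)
      (sub_mem (mul_mem (pow_mem hu' 2) k₂) h₂) (mul_mem (ofNat_mem _ _) hr')) ?_
    rw [variableChange_a₂]
    linear_combination (W.a₂ - C.s * W.a₁ + 3 * C.r - C.s ^ 2) * inv_mul 2
  · refine val_le_one_of_quadratic (v := v) (a := W.a₃ + C.r * W.a₁)
      (b := C.u ^ 6 * (C • W).a₆ - W.a₆ - C.r * W.a₄ - C.r ^ 2 * W.a₂ - C.r ^ 3)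
      (add_mem (s := v.integer) h₃ (mul_mem hr' h₁)) (sub_mem (H := v.integer)
      (sub_mem (sub_mem (sub_mem (mul_mem (pow_mem hu' 6) k₆) h₆) (mul_mem hr' h₄))
      (mul_mem (pow_mem hr' 2) h₂)) (pow_mem hr' 3)) ?_
    rw [variableChange_a₆]
    linear_combination (W.a₆ + C.r * W.a₄ + C.r ^ 2 * W.a₂ + C.r ^ 3 - C.t * W.a₃ - C.t ^ 2
      - C.r * C.t * W.a₁) * inv_mul 6

/-- The abscissa on `C • W` of the point of abscissa `x` on `W`. -/
def VariableChange.x (C : VariableChange K) (x : K) : K := ↑C.u⁻¹ ^ 2 * (x - C.r)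

/-- The ordinate on `C • W` of the point `(x, y)` on `W`. -/
def VariableChange.y (C : VariableChange K) (x y : K) : K :=
  ↑C.u⁻¹ ^ 3 * (y - C.s * (x - C.r) - C.t)

theorem VariableChange.equation {W : WeierstrassCurve K} (C : VariableChange K) {x y : K}
    (h : W.toAffine.Equation x y) : (C • W).toAffine.Equation (C.x x) (C.y x y) := by
  rw [Affine.equation_iff'] at h ⊢
  rw [variableChange_def, VariableChange.x, VariableChange.y]
  linear_combination (↑C.u⁻¹ : K) ^ 6 * h

theorem VariableChange.partialY (W : WeierstrassCurve K) (C : VariableChange K) (x y : K) :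
    2 * C.y x y + (C • W).a₁ * C.x x + (C • W).a₃ = ↑C.u⁻¹ ^ 3 * (2 * y + W.a₁ * x + W.a₃) := by
  rw [variableChange_def, VariableChange.x, VariableChange.y]
  ring

theorem VariableChange.partialX (W : WeierstrassCurve K) (C : VariableChange K) (x y : K) :
    (C • W).a₁ * C.y x y - (3 * C.x x ^ 2 + 2 * (C • W).a₂ * C.x x + (C • W).a₄) =
      ↑C.u⁻¹ ^ 4 * (W.a₁ * y - (3 * x ^ 2 + 2 * W.a₂ * x + W.a₄) +
        C.s * (2 * y + W.a₁ * x + W.a₃)) := by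
  rw [variableChange_def, VariableChange.x, VariableChange.y]
  ring

/-- The two partial derivatives transform by a triangular matrix with integral entries, so both stay
in the maximal ideal. -/
theorem SingularAt.variableChange {v : Valuation K Γ} {W : WeierstrassCurve K}
    {C : VariableChange K} {x y : K} (hu : v C.u = 1) (hr : v C.r ≤ 1) (hs : v C.s ≤ 1)
    (ht : v C.t ≤ 1) (h : SingularAt v W x y) : SingularAt v (C • W) (C.x x) (C.y x y) := by
  obtain ⟨hx, hy, h₁, h₂⟩ := h
  have hu' : v (↑C.u⁻¹ : K) ≤ 1 := by rw [Units.val_inv_eq_inv_val, map_inv₀, hu, inv_one]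
  have hw (n : ℕ) : (↑C.u⁻¹ : K) ^ n ∈ v.integer := pow_mem (S := v.integer) hu' n
  refine ⟨mul_mem (s := v.integer) (hw 2) (sub_mem hx hr),
    mul_mem (s := v.integer) (hw 3) (sub_mem (sub_mem hy (mul_mem hs (sub_mem hx hr))) ht), ?_, ?_⟩
  · rw [VariableChange.partialX]
    exact val_mul_lt (hw 4) (v.map_add_lt h₁ (val_mul_lt hs h₂))
  · rw [VariableChange.partialY]
    exact val_mul_lt (hw 3) h₂

end Valuation

/-! ### Index divisibility, and points of order two and three. -/

section Group

/-- The class of P in the quotient has order exactly n. An infinite index is 0, so no finiteness is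
needed. -/
theorem _root_.AddSubgroup.prime_dvd_index {G : Type*} [AddCommGroup G] (H : AddSubgroup G)
    {n : ℕ} (hn : n.Prime) {P : G} (hP : P ∉ H) (h : n • P ∈ H) : n ∣ H.index := by
  have := Fact.mk hn
  have : addOrderOf (QuotientAddGroup.mk P : G ⧸ H) = n := by
    refine addOrderOf_eq_prime ?_ ?_
    · rw [← QuotientAddGroup.mk_nsmul, QuotientAddGroup.eq_zero_iff]
      exact h
    · rwa [ne_eq, QuotientAddGroup.eq_zero_iff]
  rw [← this, AddSubgroup.index]
  exact addOrderOf_dvd_natCard _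

variable {F : Type*} [Field F] [DecidableEq F] {W : WeierstrassCurve F}

theorem Affine.Point.two_nsmul_eq_zero {x y : F} (h : W.toAffine.Nonsingular x y)
    (hy : 2 * y + W.a₁ * x + W.a₃ = 0) : 2 • Affine.Point.some x y h = 0 := by
  rw [two_nsmul, Affine.Point.add_self_of_Y_eq]
  rw [Affine.negY]
  linear_combination hy

theorem Affine.Point.partialY_eq_zero {x y : F} (h : W.toAffine.Nonsingular x y)
    (h2 : 2 • Affine.Point.some x y h = 0) : 2 * y + W.a₁ * x + W.a₃ = 0 := by
  rw [two_nsmul, ← eq_neg_iff_add_eq_zero, Affine.Point.neg_some, Affine.Point.some.injEq,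
    Affine.negY] at h2
  linear_combination h2.2

/-- An affine point is of order three if its tangent meets the curve in no other point. -/
theorem Affine.Point.three_nsmul_eq_zero {x y ℓ : F} (h : W.toAffine.Nonsingular x y)
    (hy : 2 * y + W.a₁ * x + W.a₃ ≠ 0)
    (hℓ : ℓ * (2 * y + W.a₁ * x + W.a₃) = 3 * x ^ 2 + 2 * W.a₂ * x + W.a₄ - W.a₁ * y)
    (hx : ℓ ^ 2 + W.a₁ * ℓ - W.a₂ - 3 * x = 0) : 3 • Affine.Point.some x y h = 0 := by
  have hy' : y - W.toAffine.negY x y = 2 * y + W.a₁ * x + W.a₃ := by rw [Affine.negY]; ring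
  have hne : y ≠ W.toAffine.negY x y := by rwa [← sub_ne_zero, hy']
  have hs : W.toAffine.slope x x y y = ℓ := by
    rw [Affine.slope_of_Y_ne rfl hne, hy', ← hℓ, mul_div_cancel_right₀ _ hy]
  rw [succ_nsmul, two_nsmul, ← eq_neg_iff_add_eq_zero, Affine.Point.add_self_of_Y_ne hne,
    Affine.Point.neg_some, Affine.Point.some.injEq, hs]
  have e : W.toAffine.addX x x ℓ = x := by rw [Affine.addX]; linear_combination hx
  refine ⟨e, ?_⟩
  rw [Affine.addY, Affine.negAddY, e]
  simp

/-- The slope of the flex tangent is what a change of variables needs in order to make that tangent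
horizontal. -/
theorem Affine.Point.exists_slope_of_three_nsmul_eq_zero {x y : F} (h : W.toAffine.Nonsingular x y)
    (h3 : 3 • Affine.Point.some x y h = 0) :
    ∃ ℓ, ℓ * (2 * y + W.a₁ * x + W.a₃) = 3 * x ^ 2 + 2 * W.a₂ * x + W.a₄ - W.a₁ * y ∧
      ℓ ^ 2 + W.a₁ * ℓ - W.a₂ - 3 * x = 0 := by
  have hy' : y - W.toAffine.negY x y = 2 * y + W.a₁ * x + W.a₃ := by rw [Affine.negY]; ring
  rw [succ_nsmul, two_nsmul, ← eq_neg_iff_add_eq_zero] at h3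
  by_cases hne : y = W.toAffine.negY x y
  · rw [Affine.Point.add_self_of_Y_eq hne, Affine.Point.neg_some] at h3
    cases h3
  · rw [Affine.Point.add_self_of_Y_ne hne, Affine.Point.neg_some, Affine.Point.some.injEq] at h3
    refine ⟨W.toAffine.slope x x y y, ?_, ?_⟩
    · rw [Affine.slope_of_Y_ne rfl hne, hy', div_mul_cancel₀]
      rwa [← hy', sub_ne_zero]
    · have := h3.1
      rw [Affine.addX] at this
      linear_combination this

end Group

end WeierstrassCurve
namespace WeierstrassCurve

/-! ### Singular reduction on a minimal model, read off an integral model with unit c₄. -/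

section Reduction

open IsDedekindDomain.HeightOneSpectrum IsDiscreteValuationRing

variable (R : Type*) [CommRing R] [IsDomain R] [IsDiscreteValuationRing R]
  {K : Type*} [Field K] [Algebra R K] [IsFractionRing R K]

theorem val_a₆_le_one (W : WeierstrassCurve K) [W.IsIntegral R] :
    valuation K (maximalIdeal R) W.a₆ ≤ 1 := by
  rw [← integralModel_a₆_eq R W]
  exact valuation_le_one _ _

/-- A change of variables from an integral Weierstrass equation whose invariant `c₄` is a unit to
a minimal one is scaled by a unit. -/
theorem val_u_eq_one {W : WeierstrassCurve K} [W.IsElliptic] [W.IsIntegral R]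
    {C : VariableChange K} [hM : (C • W).IsMinimal R]
    (hc : valuation K (maximalIdeal R) W.c₄ = 1) :
    valuation K (maximalIdeal R) (C.u : K) = 1 := by
  set v := valuation K (maximalIdeal R) with hv
  -- The minimal model has integral c₄, equal to u⁻⁴ times a unit.
  have hle : v (↑C.u⁻¹ : K) ≤ 1 := by
    have h : v (C • W).c₄ ≤ 1 := by
      rw [← integralModel_c₄_eq R (C • W)]
      exact valuation_le_one _ _
    rw [variableChange_c₄, map_mul, hc, mul_one, map_pow] at h
    exact (pow_le_one_iff four_ne_zero).mp h
  have hΔ : v (C • W).Δ ≤ v W.Δ := by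
    rw [variableChange_Δ, map_mul, map_pow]
    exact mul_le_of_le_one_left' (pow_le_one' hle 12)
  -- `W` is itself an integral model of the same curve, so its discriminant cannot have larger
  -- valuation than that of the minimal model. The two valuations agree, and u¹² is a unit.
  have hmax := hM.val_Δ_maximal.2 (j := C⁻¹) (by simpa)
  simp only [inv_smul_smul, one_smul] at hmax
  rw [← Subtype.coe_le_coe, ← Subtype.coe_le_coe, valuation_Δ_aux_eq_of_isIntegral,
    valuation_Δ_aux_eq_of_isIntegral] at hmax
  have heq := le_antisymm hΔ (hmax hΔ)
  rw [variableChange_Δ, map_mul, map_pow] at heq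
  have h0 : v W.Δ ≠ 0 := (Valuation.ne_zero_iff _).mpr W.isUnit_Δ.ne_zero
  have h12 := (mul_eq_right₀ h0).mp heq
  have h1 : v (↑C.u⁻¹ : K) = 1 := by
    refine hle.antisymm (le_of_not_gt fun hlt ↦ ?_)
    exact (pow_lt_one₀ zero_le hlt (by norm_num)).ne h12
  rwa [Units.val_inv_eq_inv_val, map_inv₀, inv_eq_one] at h1

theorem SingularAt.variableChange_of_isMinimal {W : WeierstrassCurve K} [W.IsElliptic]
    [W.IsIntegral R] {C : VariableChange K} [(C • W).IsMinimal R]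
    (hc : valuation K (maximalIdeal R) W.c₄ = 1) {x y : K}
    (h : SingularAt (valuation K (maximalIdeal R)) W x y) :
    SingularAt (valuation K (maximalIdeal R)) (C • W) (C.x x) (C.y x y) := by
  have hu := val_u_eq_one R (C := C) hc
  obtain ⟨h₁, h₂, h₃, h₄⟩ := val_coeff_le_one R W
  obtain ⟨k₁, k₂, k₃, k₄⟩ := val_coeff_le_one R (C • W)
  obtain ⟨hr, hs, ht⟩ := VariableChange.val_le_one hu h₁ h₂ h₃ h₄ (val_a₆_le_one R W)
    k₁ k₂ k₃ k₄ (val_a₆_le_one R (C • W))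
  exact h.variableChange hu hr hs ht

variable {R} in
-- Under good reduction Δ is a unit, and the two partial derivatives generate an ideal containing Δ,
-- so they cannot both lie in the maximal ideal.
theorem SingularAt.not_hasGoodReduction {W : WeierstrassCurve K} [W.IsMinimal R] {x y : K}
    (e : W.toAffine.Equation x y) (h : SingularAt (valuation K (maximalIdeal R)) W x y) :
    ¬ W.HasGoodReduction R := by
  intro hW
  obtain ⟨h₁, h₂, h₃, h₄⟩ := val_coeff_le_one R W
  obtain ⟨hx, hy, hX, hY⟩ := h
  rw [← hW.goodReduction] at hX hY
  exact not_val_partials_lt_val_Δ h₁ h₂ h₃ h₄ hx hy e hX hY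

/-- A point of order two of singular reduction makes the index of `E₀(K)` in `E(K)` even. -/
theorem two_dvd_index [DecidableEq K] {W : WeierstrassCurve K} [W.IsElliptic]
    [W.IsIntegral R] {C : VariableChange K} [(C • W).IsMinimal R]
    (hc : valuation K (maximalIdeal R) W.c₄ = 1) {x y : K} (e : W.toAffine.Equation x y)
    (h : SingularAt (valuation K (maximalIdeal R)) W x y) (h2 : 2 * y + W.a₁ * x + W.a₃ = 0) :
    2 ∣ ((C • W).nonsingularReduction R).index := by
  have hns := Affine.equation_iff_nonsingular.mp (C.equation e)
  refine AddSubgroup.prime_dvd_index _ Nat.prime_two (P := .some _ _ hns) ?_ ?_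
  · exact fun hP ↦ (hasNonsingularReduction_some_iff R _ hns).mp hP
      (h.variableChange_of_isMinimal R hc)
  · rw [Affine.Point.two_nsmul_eq_zero]
    · exact zero_mem _
    · rw [VariableChange.partialY, h2, mul_zero]

/-- The origin is a point of order three on `y² + a₁xy + a₃y = x³`; if it has singular reduction,
then the index of `E₀(K)` in `E(K)` is divisible by three. -/
theorem three_dvd_index [DecidableEq K] {a₁ a₃ : K} [(⟨a₁, 0, a₃, 0, 0⟩ : WeierstrassCurve K).IsElliptic]
    [(⟨a₁, 0, a₃, 0, 0⟩ : WeierstrassCurve K).IsIntegral R] {C : VariableChange K}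
    [(C • (⟨a₁, 0, a₃, 0, 0⟩ : WeierstrassCurve K)).IsMinimal R]
    (hc : valuation K (maximalIdeal R) (c₄ ⟨a₁, 0, a₃, 0, 0⟩) = 1)
    (ha : valuation K (maximalIdeal R) a₃ < 1) :
    3 ∣ ((C • (⟨a₁, 0, a₃, 0, 0⟩ : WeierstrassCurve K)).nonsingularReduction R).index := by
  set W : WeierstrassCurve K := ⟨a₁, 0, a₃, 0, 0⟩ with hW
  have e : W.toAffine.Equation 0 0 := by rw [Affine.equation_zero]
  have ha0 : a₃ ≠ 0 := by
    rintro rfl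
    refine W.isUnit_Δ.ne_zero ?_
    simp [hW, Δ, b₂, b₄, b₆, b₈]
  have hns := Affine.equation_iff_nonsingular.mp (C.equation e)
  refine AddSubgroup.prime_dvd_index _ Nat.prime_three (P := .some _ _ hns) ?_ ?_
  · refine fun hP ↦ (hasNonsingularReduction_some_iff R _ hns).mp hP
      (SingularAt.variableChange_of_isMinimal R hc ⟨by simp, by simp, ?_, ?_⟩)
    · simp [hW]
    · simpa [hW]
  · rw [Affine.Point.three_nsmul_eq_zero (ℓ := -(↑C.u⁻¹ * C.s)) hns]
    · exact zero_mem _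
    · rw [VariableChange.partialY]
      simpa [hW] using ha0
    · have h := C.partialX W 0 0
      rw [VariableChange.partialY]
      simp only [hW] at h ⊢
      linear_combination h
    · simp only [hW, variableChange_def, VariableChange.x]
      ring

end Reduction

end WeierstrassCurve
namespace WeierstrassCurve

/-! ### Criteria over ℚ_p in terms of an integer model. -/

section Padic

open IsDedekindDomain.HeightOneSpectrum IsDiscreteValuationRing

theorem padic_val_intCast_le_one (p : ℕ) [Fact p.Prime] (n : ℤ) :
    valuation ℚ_[p] (maximalIdeal ℤ_[p]) (n : ℚ_[p]) ≤ 1 := by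
  rw [← PadicInt.coe_intCast]
  exact valuation_le_one (K := ℚ_[p]) (maximalIdeal ℤ_[p]) (n : ℤ_[p])

theorem padic_val_intCast_lt_one_iff (p : ℕ) [Fact p.Prime] (n : ℤ) :
    valuation ℚ_[p] (maximalIdeal ℤ_[p]) (n : ℚ_[p]) < 1 ↔ (p : ℤ) ∣ n := by
  rw [← PadicInt.norm_int_lt_one_iff_dvd, ← PadicInt.mem_nonunits, ← PadicInt.coe_intCast]
  exact valuation_lt_one_iff_mem (K := ℚ_[p]) (maximalIdeal ℤ_[p]) (n : ℤ_[p])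

theorem padic_val_intCast_eq_one (p : ℕ) [Fact p.Prime] {n : ℤ} (hn : ¬ (p : ℤ) ∣ n) :
    valuation ℚ_[p] (maximalIdeal ℤ_[p]) (n : ℚ_[p]) = 1 :=
  (padic_val_intCast_le_one p n).antisymm
    (not_lt.mp fun h ↦ hn ((padic_val_intCast_lt_one_iff p n).mp h))

theorem exists_minimal_eq_smul {E : WeierstrassCurve ℚ} {W : WeierstrassCurve ℤ}
    {C : VariableChange ℚ} (hE : E = C • W.map (Int.castRingHom ℚ)) (p : ℕ) [Fact p.Prime] :
    ∃ C' : VariableChange ℚ_[p],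
      (E.baseChange ℚ_[p]).minimal ℤ_[p] = C' • W.map (Int.castRingHom ℚ_[p]) := by
  refine ⟨((E.baseChange ℚ_[p]).exists_isMinimal ℤ_[p]).choose * C.map (algebraMap ℚ ℚ_[p]), ?_⟩
  rw [mul_smul, minimal]
  congr 1
  rw [baseChange, hE, ← map_variableChange, map_map]
  congr 2

theorem isElliptic_map_padic {E : WeierstrassCurve ℚ} [E.IsElliptic] {W : WeierstrassCurve ℤ}
    {C : VariableChange ℚ} (hE : E = C • W.map (Int.castRingHom ℚ)) (p : ℕ) [Fact p.Prime] :
    (W.map (Int.castRingHom ℚ_[p])).IsElliptic := by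
  have h : E.Δ ≠ 0 := E.isUnit_Δ.ne_zero
  rw [hE, variableChange_Δ, map_Δ] at h
  have h' : W.Δ ≠ 0 := by
    rintro h0
    simp [h0] at h
  rw [isElliptic_iff, map_Δ, isUnit_iff_ne_zero]
  simpa using h'

instance isIntegral_map_padic (W : WeierstrassCurve ℤ) (p : ℕ) [Fact p.Prime] :
    (W.map (Int.castRingHom ℚ_[p])).IsIntegral ℤ_[p] := by
  refine ⟨W.map (Int.castRingHom ℤ_[p]), ?_⟩
  rw [baseChange, map_map]
  congr 1

theorem padic_val_c₄_eq_one {W : WeierstrassCurve ℤ} {p : ℕ} [Fact p.Prime]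
    (hc : ¬ (p : ℤ) ∣ W.c₄) :
    valuation ℚ_[p] (maximalIdeal ℤ_[p]) (W.map (Int.castRingHom ℚ_[p])).c₄ = 1 := by
  rw [map_c₄]
  exact padic_val_intCast_eq_one p hc

theorem hasBadReductionAt_and_two_dvd {E : WeierstrassCurve ℚ} [E.IsElliptic]
    {W : WeierstrassCurve ℤ} {C : VariableChange ℚ} (hE : E = C • W.map (Int.castRingHom ℚ))
    (p : ℕ) [Fact p.Prime] (hc : ¬ (p : ℤ) ∣ W.c₄) {x y : ℤ} (e : W.toAffine.Equation x y)
    (hx : (p : ℤ) ∣ W.a₁ * y - (3 * x ^ 2 + 2 * W.a₂ * x + W.a₄))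
    (hy : 2 * y + W.a₁ * x + W.a₃ = 0) :
    E.HasBadReductionAt p ∧ 2 ∣ E.localTamagawaNumber p := by
  classical
  obtain ⟨C', hC'⟩ := exists_minimal_eq_smul hE p
  have := isElliptic_map_padic hE p
  have hc' := padic_val_c₄_eq_one hc
  have e' := e.map (Int.castRingHom ℚ_[p])
  have hy' : 2 * (y : ℚ_[p]) + W.a₁ * x + W.a₃ = 0 := by exact_mod_cast hy
  have hs : SingularAt (valuation ℚ_[p] (maximalIdeal ℤ_[p])) (W.map (Int.castRingHom ℚ_[p]))
      x y := by
    refine ⟨padic_val_intCast_le_one p x, padic_val_intCast_le_one p y, ?_, ?_⟩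
    · have := (padic_val_intCast_lt_one_iff p _).mpr hx
      push_cast at this
      exact this
    · simp only [map_a₁, map_a₃, eq_intCast, hy', map_zero, zero_lt_one]
  -- The subgroup of nonsingular reduction depends on the minimality of the model, so the claim is
  -- proved for every minimal V of this form instead of rewriting along `hC'`.
  have key : ∀ V : WeierstrassCurve ℚ_[p], ∀ _ : V.IsMinimal ℤ_[p],
      V = C' • W.map (Int.castRingHom ℚ_[p]) →
      ¬ V.HasGoodReduction ℤ_[p] ∧ 2 ∣ (V.nonsingularReduction ℤ_[p]).index := by
    rintro _ _ rfl
    exact ⟨(hs.variableChange_of_isMinimal ℤ_[p] hc').not_hasGoodReduction (C'.equation e'),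
      two_dvd_index ℤ_[p] hc' e' hs hy'⟩
  obtain ⟨h₁, h₂⟩ := key _ inferInstance hC'
  exact ⟨h₁, by convert! h₂⟩

theorem three_dvd_localTamagawaNumber {E : WeierstrassCurve ℚ} [E.IsElliptic]
    {a₁ a₃ : ℤ} {C : VariableChange ℚ}
    (hE : E = C • (⟨a₁, 0, a₃, 0, 0⟩ : WeierstrassCurve ℤ).map (Int.castRingHom ℚ))
    (p : ℕ) [Fact p.Prime] (hc : ¬ (p : ℤ) ∣ c₄ ⟨a₁, 0, a₃, 0, 0⟩) (ha : (p : ℤ) ∣ a₃) :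
    3 ∣ E.localTamagawaNumber p := by
  classical
  obtain ⟨C', hC'⟩ := exists_minimal_eq_smul hE p
  have h₁ := isElliptic_map_padic hE p
  have h₂ := isIntegral_map_padic ⟨a₁, 0, a₃, 0, 0⟩ p
  have hc' := padic_val_c₄_eq_one hc
  have hW : (⟨a₁, 0, a₃, 0, 0⟩ : WeierstrassCurve ℤ).map (Int.castRingHom ℚ_[p]) =
      ⟨a₁, 0, a₃, 0, 0⟩ := by simp [map]
  rw [hW] at hC' h₁ h₂ hc'
  have key : ∀ V : WeierstrassCurve ℚ_[p], ∀ _ : V.IsMinimal ℤ_[p],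
      V = C' • ⟨a₁, 0, a₃, 0, 0⟩ → 3 ∣ (V.nonsingularReduction ℤ_[p]).index := by
    rintro _ _ rfl
    exact three_dvd_index ℤ_[p] hc' ((padic_val_intCast_lt_one_iff p a₃).mpr ha)
  convert! key _ inferInstance hC'

end Padic

/-! ### Tamagawa numbers of the family with full two-torsion and a point of order three. -/

section FullTwoTorsion

/-- The elliptic curves with full two-torsion and a point of order three: if `A + B + 2 * D = 0`,
then `-(B * D) ^ 2`, `-(A * D) ^ 2` and `-(A * B / 2) ^ 2` are the abscissae of the points of order
two, and `(0, 0)` is a point of order three. -/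
def twoSixCurve (A B D : ℤ) : WeierstrassCurve ℤ := ⟨4 * D ^ 2 - A * B, 0, (A * B * D) ^ 2, 0, 0⟩

/-- This symmetry reduces primes dividing A to primes dividing B. -/
theorem twoSixCurve_comm (A B D : ℤ) : twoSixCurve A B D = twoSixCurve B A D := by
  simp only [twoSixCurve, mul_comm A B]

theorem twoSixCurve_c₄ (A B D : ℤ) : (twoSixCurve A B D).c₄ = (4 * D ^ 2 - A * B) ^ 4 -
    24 * (4 * D ^ 2 - A * B) * (A * B * D) ^ 2 := by
  simp only [twoSixCurve, c₄, b₂, b₄]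
  ring

/-- The point of order 2 with parameter m = BD is (-m², -m³). The X-derivative there is -m³(a₁ +
3m), and `hp` asks p to divide m(a₁ + 3m). -/
theorem hasBadReductionAt_and_two_dvd_of_twoSixCurve {E : WeierstrassCurve ℚ} [E.IsElliptic]
    {A B D : ℤ} {C : VariableChange ℚ} (h : A + B + 2 * D = 0)
    (hE : E = C • (twoSixCurve A B D).map (Int.castRingHom ℚ)) (p : ℕ) [Fact p.Prime]
    (hc : ¬ (p : ℤ) ∣ (twoSixCurve A B D).c₄)
    (hp : (p : ℤ) ∣ (B * D) * (4 * D ^ 2 - A * B + 3 * (B * D))) :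
    E.HasBadReductionAt p ∧ 2 ∣ E.localTamagawaNumber p := by
  obtain rfl : A = -B - 2 * D := by linear_combination h
  refine hasBadReductionAt_and_two_dvd hE p hc (x := -(B * D) ^ 2) (y := -(B * D) ^ 3) ?_ ?_ ?_
  · rw [Affine.equation_iff]
    simp only [twoSixCurve]
    ring
  · refine hp.trans ⟨-(B * D) ^ 2, ?_⟩
    simp only [twoSixCurve]
    ring
  · simp only [twoSixCurve]
    ring

theorem two_of_twoSixCurve {E : WeierstrassCurve ℚ} [E.IsElliptic]
    {A B D : ℤ} {C : VariableChange ℚ} (h : A + B + 2 * D = 0) (hA : Odd A) (hB : Odd B)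
    (hE : E = C • (twoSixCurve A B D).map (Int.castRingHom ℚ)) :
    E.HasBadReductionAt 2 ∧ 2 ∣ E.localTamagawaNumber 2 := by
  refine hasBadReductionAt_and_two_dvd_of_twoSixCurve h hE 2 ?_ ?_
  -- Here c₄ ≡ (AB)⁴ mod 2, which is odd.
  · rw [twoSixCurve_c₄]
    push_cast
    rw [← even_iff_two_dvd]
    have : ¬ Even A := by simpa
    have : ¬ Even B := by simpa
    simp_all [parity_simps, show Even (4 : ℤ) by decide, show Even (24 : ℤ) by decide]
  -- If D is even, so is BD. If D is odd, then AB and 3BD are both odd and the second factor is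
  -- even.
  · push_cast
    rw [← even_iff_two_dvd]
    have : ¬ Even A := by simpa
    have : ¬ Even B := by simpa
    have : ¬ Even (3 : ℤ) := by decide
    have : Even (4 : ℤ) := by decide
    simp only [Int.even_mul, Int.even_add, Int.even_sub]
    tauto

theorem six_dvd_of_twoSixCurve {E : WeierstrassCurve ℚ} [E.IsElliptic]
    {A B D : ℤ} {C : VariableChange ℚ} (h : A + B + 2 * D = 0) (hAB : IsCoprime A B)
    (hE : E = C • (twoSixCurve A B D).map (Int.castRingHom ℚ)) {p : ℕ} [hp : Fact p.Prime]
    (hp2 : p ≠ 2) (hpB : (p : ℤ) ∣ B) :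
    E.HasBadReductionAt p ∧ 6 ∣ E.localTamagawaNumber p := by
  have hP : Prime (p : ℤ) := Nat.prime_iff_prime_int.mp hp.out
  have hA : ¬ (p : ℤ) ∣ A := fun hA ↦ hP.not_isUnit (hAB.isUnit_of_dvd' hA hpB)
  have h2 : ¬ (p : ℤ) ∣ 2 := by
    intro h2
    exact hp2 ((Nat.prime_dvd_prime_iff_eq hp.out Nat.prime_two).mp (by exact_mod_cast h2))
  have hD : ¬ (p : ℤ) ∣ D := by
    intro hD
    refine hA ?_
    rw [show A = -B + D * (-2) by linear_combination h]
    exact dvd_add (hpB.neg_right) (hD.mul_right _)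
  have hc : ¬ (p : ℤ) ∣ (twoSixCurve A B D).c₄ := by
    intro hc
    rw [twoSixCurve_c₄] at hc
    -- Modulo B only the term (4D²)⁴ of c₄ survives.
    have h3 : (p : ℤ) ∣ (2 * D) ^ 8 := by
      obtain ⟨k, rfl⟩ := hpB
      obtain ⟨l, hl⟩ := hc
      exact ⟨l + k * A * (8 * D ^ 2 - A * (p * k)) *
        ((4 * D ^ 2 - A * (p * k)) ^ 2 + (4 * D ^ 2) ^ 2) +
        24 * (4 * D ^ 2 - A * (p * k)) * A ^ 2 * p * k ^ 2 * D ^ 2, by linear_combination hl⟩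
    exact (hP.dvd_or_dvd (hP.dvd_of_dvd_pow h3)).elim h2 hD
  obtain ⟨h₁, h₂⟩ := hasBadReductionAt_and_two_dvd_of_twoSixCurve h hE p hc
    ((hpB.mul_right _).mul_right _)
  refine ⟨h₁, Nat.Coprime.mul_dvd_of_dvd_of_dvd (by norm_num : Nat.Coprime 2 3) h₂ ?_⟩
  exact three_dvd_localTamagawaNumber hE p hc
    (dvd_pow ((hpB.mul_left _).mul_right _) two_ne_zero)

theorem exists_odd_prime_dvd {n : ℤ} (hn : Odd n) (h1 : n ≠ 1) (h2 : n ≠ -1) :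
    ∃ p : ℕ, p.Prime ∧ p ≠ 2 ∧ (p : ℤ) ∣ n := by
  obtain ⟨p, hp, hpn⟩ := Nat.exists_prime_and_dvd (n := n.natAbs) (by omega)
  refine ⟨p, hp, ?_, Int.natCast_dvd.mpr hpn⟩
  rintro rfl
  obtain ⟨k, rfl⟩ := hn
  omega

theorem twelve_dvd_tamagawaNumber_of_twoSixCurve {E : WeierstrassCurve ℚ} [E.IsElliptic]
    {A B D : ℤ} {C : VariableChange ℚ} (h : A + B + 2 * D = 0) (hA : Odd A) (hB : Odd B)
    (hAB : IsCoprime A B) (hE : E = C • (twoSixCurve A B D).map (Int.castRingHom ℚ)) :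
    12 ∣ E.tamagawaNumber := by
  have hΔ : (twoSixCurve A B D).Δ ≠ 0 := by
    intro h0
    have := E.isUnit_Δ.ne_zero
    rw [hE, variableChange_Δ, map_Δ, h0, map_zero, mul_zero] at this
    exact this rfl
  have hD0 : D ≠ 0 := by
    rintro rfl
    refine hΔ ?_
    simp only [twoSixCurve, Δ, b₂, b₄, b₆, b₈]
    ring
  have hne : A ≠ B := by
    rintro rfl
    obtain rfl : D = -A := by omega
    refine hΔ ?_
    simp only [twoSixCurve, Δ, b₂, b₄, b₆, b₈]
    ring
  -- If A and B were both ±1, then A = B or A = -B, that is D = 0. Both are excluded by Δ ≠ 0.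
  obtain ⟨p, hp, hp2, hpAB⟩ : ∃ p : ℕ, p.Prime ∧ p ≠ 2 ∧ ((p : ℤ) ∣ A ∨ (p : ℤ) ∣ B) := by
    by_cases hA1 : A ≠ 1 ∧ A ≠ -1
    · obtain ⟨p, hp, hp2, hpA⟩ := exists_odd_prime_dvd hA hA1.1 hA1.2
      exact ⟨p, hp, hp2, .inl hpA⟩
    · obtain ⟨p, hp, hp2, hpB⟩ := exists_odd_prime_dvd hB (by omega) (by omega)
      exact ⟨p, hp, hp2, .inr hpB⟩
  have := Fact.mk hp
  have h6 : E.HasBadReductionAt p ∧ 6 ∣ E.localTamagawaNumber p := by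
    rcases hpAB with hpA | hpB
    · rw [twoSixCurve_comm] at hE
      exact six_dvd_of_twoSixCurve (by linear_combination h) hAB.symm hE hp2 hpA
    · exact six_dvd_of_twoSixCurve h hAB hE hp2 hpB
  have h2 := two_of_twoSixCurve h hA hB hE
  -- Finiteness turns the `finprod` into a genuine finite product, of which the factors at 2 and p
  -- form a subproduct.
  have hfin := E.finite_setOf_hasBadReductionAt
  rw [tamagawaNumber]
  change 12 ∣ ∏ᶠ (q : Nat.Primes) (_ : q ∈ {q : Nat.Primes | E.HasBadReductionAt q}),
    E.localTamagawaNumber q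
  rw [finprod_mem_eq_finite_toFinset_prod _ hfin]
  let p₂ : Nat.Primes := ⟨2, Nat.prime_two⟩
  let p' : Nat.Primes := ⟨p, hp⟩
  have hpp : p₂ ≠ p' := fun hh ↦ hp2 (congrArg Subtype.val hh).symm
  refine dvd_trans ?_ (Finset.prod_dvd_prod_of_subset {p₂, p'} _ _ ?_)
  · rw [Finset.prod_pair hpp]
    exact mul_dvd_mul h2.2 h6.2
  · intro q hq
    rw [Set.Finite.mem_toFinset]
    rw [Finset.mem_insert, Finset.mem_singleton] at hq
    rcases hq with rfl | rfl
    · exact h2.1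
    · exact h6.1

end FullTwoTorsion

end WeierstrassCurve
namespace WeierstrassCurve

/-! ### Reduction of the curve to the family `twoSixCurve`. -/

section NormalForm

/-- A Weierstrass equation with a point of order three at the origin and a horizontal tangent
there. -/
theorem exists_smul_eq_of_three_nsmul {F : Type*} [Field F] [DecidableEq F]
    {E : WeierstrassCurve F} {x y : F} (h : E.toAffine.Nonsingular x y)
    (h3 : 3 • Affine.Point.some x y h = 0) :
    ∃ (C : VariableChange F) (a₁ a₃ : F), C • E = ⟨a₁, 0, a₃, 0, 0⟩ := by
  obtain ⟨ℓ, h₁, h₂⟩ := Affine.Point.exists_slope_of_three_nsmul_eq_zero h h3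
  have he := (Affine.equation_iff ..).mp h.1
  refine ⟨⟨1, x, ℓ, y⟩, E.a₁ + 2 * ℓ, E.a₃ + x * E.a₁ + 2 * y, ?_⟩
  rw [variableChange_def]
  ext <;> simp only [inv_one, Units.val_one, one_pow, one_mul]
  · linear_combination -h₂
  · linear_combination -h₁
  · linear_combination -he

/-- The points of order two on `y² + a₁xy + a₃y = x³` correspond to the roots of a cubic. -/
theorem exists_root_of_partialY_eq_zero {F : Type*} [Field F] {a₁ a₃ x y : F} (ha : a₃ ≠ 0)
    (e : Affine.Equation ⟨a₁, 0, a₃, 0, 0⟩ x y) (h : 2 * y + a₁ * x + a₃ = 0) :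
    ∃ m, x = -m ^ 2 ∧ m ≠ 0 ∧ 2 * m ^ 3 + a₁ * m ^ 2 - a₃ = 0 := by
  rw [Affine.equation_iff] at e
  dsimp only at e
  -- Subtracting y times the condition of order 2 from the equation puts the point on the cuspidal
  -- cubic x³ = -y², parametrised by m = y/x as (-m², -m³).
  have hxy : x ^ 3 = -y ^ 2 := by linear_combination y * h - e
  have hx : x ≠ 0 := by
    rintro rfl
    have hy : y = 0 := by simpa using hxy.symm
    exact ha (by simpa [hy] using h)
  have hy : y ≠ 0 := by
    rintro rfl
    exact hx (by simpa using hxy)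
  have hm : x = -(y / x) ^ 2 := by
    field_simp
    linear_combination hxy
  have hy' : y = (y / x) * x := by field_simp
  generalize y / x = m at hm hy'
  subst hm
  refine ⟨m, rfl, ?_, ?_⟩
  · rintro rfl
    simp at hx
  · linear_combination -h + 2 * hy'

/-- The reciprocals of the mᵢ sum to zero, hence are proportional to A, B, -(A + B), where A/B is
m₂/m₁ in lowest terms. Then m₁ = -cB(A + B), m₂ = -cA(A + B), m₃ = cAB. -/
theorem exists_coprime_of_sum_eq_zero {m₁ m₂ m₃ : ℚ} (h₁ : m₁ ≠ 0) (h₂ : m₂ ≠ 0)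
    (h₁₂ : m₁ + m₂ ≠ 0) (h : m₁ * m₂ + m₂ * m₃ + m₁ * m₃ = 0) :
    ∃ (A B : ℤ) (c : ℚ), c ≠ 0 ∧ IsCoprime A B ∧
      m₁ + m₂ + m₃ = -c * (A ^ 2 + A * B + B ^ 2 : ℤ) ∧
      m₁ * m₂ * m₃ = c ^ 3 * ((A * B * (A + B)) ^ 2 : ℤ) := by
  set q : ℚ := m₂ / m₁ with hq
  have hq0 : q ≠ 0 := div_ne_zero h₂ h₁
  have hB : (q.den : ℚ) ≠ 0 := by exact_mod_cast q.den_ne_zero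
  have hA : (q.num : ℚ) ≠ 0 := by exact_mod_cast Rat.num_ne_zero.mpr hq0
  have hqd : (q.num : ℚ) / q.den = q := Rat.num_div_den q
  have hm : m₂ * q.den = m₁ * q.num := by
    have : m₂ = q * m₁ := by rw [hq]; field_simp
    rw [this]
    nth_rw 1 [← hqd]
    field_simp
  have hAB : (q.num : ℚ) + q.den ≠ 0 := by
    intro h0
    refine h₁₂ ((mul_eq_zero_iff_right hB).mp ?_)
    linear_combination hm + m₁ * h0
  refine ⟨q.num, q.den, -m₁ / (q.den * (q.num + q.den)),
    div_ne_zero (neg_ne_zero.mpr h₁) (mul_ne_zero hB hAB), Rat.isCoprime_num_den q, ?_⟩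
  push_cast
  clear_value q
  generalize (q.num : ℚ) = a at *
  generalize (q.den : ℚ) = b at *
  obtain rfl : m₂ = m₁ * a / b := by rw [← hm]; field_simp
  have hm₃ : m₃ = -m₁ * a / (a + b) := by
    rw [eq_div_iff hAB]
    refine mul_left_cancel₀ h₁ ?_
    field_simp at h
    linear_combination h
  subst hm₃
  constructor
  · field_simp
    ring
  · field_simp

/-- Both expressions are symmetric in A, B, -(A + B), which sum to zero and are pairwise coprime, so
exactly one of them is even and can be dropped. -/
theorem exists_odd_of_coprime {A B : ℤ} (h : IsCoprime A B) :
    ∃ A' B' : ℤ, IsCoprime A' B' ∧ Odd A' ∧ Odd B' ∧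
      A' ^ 2 + A' * B' + B' ^ 2 = A ^ 2 + A * B + B ^ 2 ∧
      (A' * B' * (A' + B')) ^ 2 = (A * B * (A + B)) ^ 2 := by
  rcases Int.even_or_odd A with hA | hA <;> rcases Int.even_or_odd B with hB | hB
  · have := h.isUnit_of_dvd' hA.two_dvd hB.two_dvd
    exact absurd this (by decide)
  · refine ⟨B, -(A + B), ?_, hB, (hA.add_odd hB).neg, by ring, by ring⟩
    rw [IsCoprime.neg_right_iff]
    simpa using h.symm.add_mul_left_right 1
  · refine ⟨A, -(A + B), ?_, hA, (hA.add_even hB).neg, by ring, by ring⟩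
    rw [IsCoprime.neg_right_iff, add_comm]
    simpa using h.add_mul_left_right 1
  · exact ⟨A, B, h, hA, hB, rfl, rfl⟩

theorem exists_twoSixCurve {E : WeierstrassCurve ℚ} [E.IsElliptic] {P : E.toAffine.Point}
    (hP : P ≠ 0) (hP3 : 3 • P = 0) {T : Fin 3 → E.toAffine.Point} (hT : Function.Injective T)
    (hT0 : ∀ i, T i ≠ 0) (hT2 : ∀ i, 2 • T i = 0) :
    ∃ (A B D : ℤ) (C : VariableChange ℚ), A + B + 2 * D = 0 ∧ Odd A ∧ Odd B ∧ IsCoprime A B ∧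
      E = C • (twoSixCurve A B D).map (Int.castRingHom ℚ) := by
  obtain ⟨C, a₁, a₃, hC⟩ : ∃ (C : VariableChange ℚ) (a₁ a₃ : ℚ), C • E = ⟨a₁, 0, a₃, 0, 0⟩ := by
    rcases P with _ | ⟨x, y, h⟩
    · exact absurd rfl hP
    · exact exists_smul_eq_of_three_nsmul h hP3
  have ha₃ : a₃ ≠ 0 := by
    rintro rfl
    refine (C • E).isUnit_Δ.ne_zero ?_
    rw [hC]
    simp [Δ, b₂, b₄, b₆, b₈]
  have hx : ∃ x : Fin 3 → ℚ, Function.Injective x ∧ ∀ i, ∃ y, E.toAffine.Equation (x i) y ∧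
      2 * y + E.a₁ * x i + E.a₃ = 0 := by
    have (i : Fin 3) : ∃ (x y : ℚ) (h : E.toAffine.Nonsingular x y), T i = .some x y h := by
      rcases hi : T i with _ | ⟨x, y, h⟩
      · exact absurd hi (hT0 i)
      · exact ⟨x, y, h, rfl⟩
    choose x y h hxy using this
    have hy (i : Fin 3) : 2 * y i + E.a₁ * x i + E.a₃ = 0 :=
      Affine.Point.partialY_eq_zero (h i) (hxy i ▸ hT2 i)
    -- A point of order 2 is its own negative, so its abscissa determines its ordinate.
    refine ⟨x, fun i j hij ↦ hT ?_, fun i ↦ ⟨y i, (h i).1, hy i⟩⟩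
    have hij' : y i = y j := by linear_combination (hy i - hy j - E.a₁ * hij) / 2
    rw [hxy, hxy, Affine.Point.some.injEq]
    exact ⟨hij, hij'⟩
  obtain ⟨x, hxi, hx⟩ := hx
  have hm (i : Fin 3) : ∃ m : ℚ, C.x (x i) = -m ^ 2 ∧ m ≠ 0 ∧ 2 * m ^ 3 + a₁ * m ^ 2 - a₃ = 0 := by
    obtain ⟨y, e, hy⟩ := hx i
    have e' := C.equation e
    have hy' := C.partialY E (x i) y
    rw [hy, mul_zero, hC] at hy'
    rw [hC] at e'
    exact exists_root_of_partialY_eq_zero ha₃ e' hy'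
  choose m hmx hm0 hm using hm
  have hne (i j : Fin 3) (hij : i ≠ j) : m i - m j ≠ 0 ∧ m i + m j ≠ 0 := by
    rw [← mul_ne_zero_iff]
    intro h0
    refine hij (hxi ?_)
    have h1 : C.x (x i) = C.x (x j) := by rw [hmx, hmx]; linear_combination -h0
    rw [VariableChange.x, VariableChange.x] at h1
    have := mul_left_cancel₀ (pow_ne_zero 2 C.u⁻¹.ne_zero) h1
    linear_combination this
  have h01 := hne 0 1 (by decide)
  have h02 := hne 0 2 (by decide)
  have h12 := hne 1 2 (by decide)
  -- Divided differences of the cubic at its distinct roots yield Vieta's formulas. The missing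
  -- linear term gives `hsum`.
  have k01 : 2 * (m 0 ^ 2 + m 0 * m 1 + m 1 ^ 2) + a₁ * (m 0 + m 1) = 0 := by
    refine mul_left_cancel₀ h01.1 ?_
    linear_combination hm 0 - hm 1
  have k02 : 2 * (m 0 ^ 2 + m 0 * m 2 + m 2 ^ 2) + a₁ * (m 0 + m 2) = 0 := by
    refine mul_left_cancel₀ h02.1 ?_
    linear_combination hm 0 - hm 2
  have ha₁ : a₁ = -2 * (m 0 + m 1 + m 2) := by
    have : 2 * (m 0 + m 1 + m 2) + a₁ = 0 := by
      refine mul_left_cancel₀ h12.1 ?_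
      linear_combination k01 - k02
    linear_combination this
  have hsum : m 0 * m 1 + m 1 * m 2 + m 0 * m 2 = 0 := by
    rw [ha₁] at k01
    linear_combination -k01 / 2
  have ha₃' : a₃ = 2 * (m 0 * m 1 * m 2) := by
    have := hm 0
    rw [ha₁] at this
    linear_combination -this - 2 * m 0 * hsum
  obtain ⟨A, B, c, hc, hAB, hs, hp⟩ :=
    exists_coprime_of_sum_eq_zero (hm0 0) (hm0 1) h01.2 hsum
  obtain ⟨A', B', hAB', hA', hB', hs', hp'⟩ := exists_odd_of_coprime hAB
  rw [← hs'] at hs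
  rw [← hp'] at hp
  obtain ⟨D, hD⟩ : ∃ D, A' + B' + 2 * D = 0 := by
    obtain ⟨k, hk⟩ := hA'.add_odd hB'
    exact ⟨-k, by linear_combination hk⟩
  -- Since A' + B' = -2D, the coefficients are a₁ = 2c(4D² - A'B') and a₃ = (2c)³(A'B'D)². Scaling
  -- with u⁻¹ = 2c multiplies aᵢ by (2c)ⁱ.
  let C₁ : VariableChange ℚ := ⟨(Units.mk0 (2 * c) (mul_ne_zero two_ne_zero hc))⁻¹, 0, 0, 0⟩
  refine ⟨A', B', D, C⁻¹ * C₁, hD, hA', hB', hAB', ?_⟩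
  rw [mul_smul, eq_inv_smul_iff, hC, variableChange_def]
  have hD' : (A' : ℚ) = -B' - 2 * D := by
    rw [show A' = -B' - 2 * D by linear_combination hD]
    push_cast
    ring
  push_cast at hs hp
  ext <;> simp [C₁, twoSixCurve]
  · rw [ha₁, hs, hD']
    ring
  · rw [ha₃', hp, hD']
    ring

end NormalForm

end WeierstrassCurve

theorem proposition2p2 (E : WeierstrassCurve ℚ) [E.IsElliptic]
    (h : Nonempty (AddCommGroup.torsion E.toAffine.Point ≃+ ZMod 2 × ZMod 6)) :
    Nat.card (AddCommGroup.torsion E.toAffine.Point) ∣ E.tamagawaNumber := by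
  obtain ⟨e⟩ := h
  rw [Nat.card_congr e.toEquiv]
  have hcard : Nat.card (ZMod 2 × ZMod 6) = 12 := by simp
  rw [hcard]
  let f : ZMod 2 × ZMod 6 →+ E.toAffine.Point :=
    (AddCommGroup.torsion E.toAffine.Point).subtype.comp e.symm.toAddMonoidHom
  have hf : Function.Injective f := Subtype.val_injective.comp e.symm.injective
  have hf0 (a : ZMod 2 × ZMod 6) (ha : a ≠ 0) : f a ≠ 0 := (map_ne_zero_iff f hf).mpr ha
  have hfn (n : ℕ) (a : ZMod 2 × ZMod 6) (ha : n • a = 0) : n • f a = 0 := by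
    rw [← map_nsmul, ha, map_zero]
  -- (0, 2) has order 3, and (1, 0), (0, 3), (1, 3) are the three elements of order 2.
  obtain ⟨A, B, D, C, hD, hA, hB, hAB, hE⟩ := WeierstrassCurve.exists_twoSixCurve
    (P := f (0, 2)) (hf0 _ (by decide)) (hfn 3 _ (by decide))
    (T := fun i ↦ f (![(1, 0), (0, 3), (1, 3)] i)) (hf.comp (by decide))
    (fun i ↦ hf0 _ (by revert i; decide)) (fun i ↦ hfn 2 _ (by revert i; decide))
  exact WeierstrassCurve.twelve_dvd_tamagawaNumber_of_twoSixCurve hD hA hB hAB hE
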